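/- All Banach spaces are real. Let $X$ be a Banach space with a (Schauder) basis $(b_i)_{i\in\mathbb N}$, $\mathbb N=\{0,1,2,\dots\}$. A block basis of $(b_i)$ is a sequence of non-zero vectors $y_k=\sum_{l=p_k}^{p_{k+1}-1}a_l b_l$ with $a_l\in\mathbb R$ and $p_0<p_1<\cdots$ in $\mathbb N$ (and similarly for finite sequences). (1) There exists an equivalent norm $|||\cdot|||$ on $X$ such that, if there are $|||\cdot|||$-normalized block bases $(x_m)$ and $(y_n)$ of $(b_i)$ satisfying both $\lim_{m\to\infty}\lim_{n\to\infty}|||x_m+y_n|||=2$ and $\lim_{m\to\infty}\lim_{n\to\infty}|||x_m-y_n|||=2$, then $X$ contains an isomorph of $\ell_1$. (2) If $X$ does not contain an isomorph of $\ell_1$, then there exists an equivalent norm $|||\cdot|||$ on $X$ such that, if $(e_n)$ is any asymptotic model of $(X,|||\cdot|||)$ generated by a block basic array with respect to $(b_i)$, then $(e_n)$ is not $1$-equivalent to the unit vector basis of $\ell_1$. Here the following terminology is used. A (finite or infinite) sequence of non-zero vectors $(x_i)$ is $K$-basic if $\|\sum_{i<n}a_ix_i\|\le K\|\sum_{i<m}a_ix_i\|$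 for all scalars $a_i$ and all $n\le m$ (with $m$ at most the length of the sequence). An array $(x^n_i)_{n,i\in\mathbb N}$ of norm-one vectors is a basic array if, for some $K<\infty$, every row $(x^n_i)_{i\in\mathbb N}$ is $K$-basic and every sequence $(x^j_{i_j})_{j<m}$ with $m\le i_0<\dots<i_{m-1}$ is $K$-basic; it is a block basic array with respect to $(b_i)$ if moreover all these rows and sequences are block bases of $(b_i)$. A basic array $(y^n_i)$ generates the asymptotic model $(e_n)$ if there are $\varepsilon_n>0$ decreasing to $0$ such that $$\Big|\,\Big\|\sum_{j<n}a_jy^j_{i_j}\Big\|-\Big\|\sum_{j<n}a_jy^j_{l_j}\Big\|\,\Big|<\varepsilon_n$$ for all $n$, all $(a_j)_{j<n}\in[-1,1]^n$ and all $n\le i_0<\dots<i_{n-1}$, $n\le l_0<\dots<l_{n-1}$, and if $(e_n)$ is a sequence with dense linear span in a Banach space $E$ such that, for all $n$ and all scalars $(a_j)_{j<n}$, $\|\sum_{j<n}a_je_j\|$ is the limit of $\|\sum_{j<n}a_jy^j_{i_j}\|$ as $i_0<\dots<i_{n-1}$ and $i_0\to\infty$. Sequences $(x_i)$ and $(y_i)$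 are $C$-equivalent if there are $A,B>0$ with $AB\le C$ and $A^{-1}\|\sum_{i<n}a_ix_i\|\le\|\sum_{i<n}a_iy_i\|\le B\|\sum_{i<n}a_ix_i\|$ for all $n$ and all scalars $a_i$. -/

import Mathlib

open Filter Topology

universe u v

/-- `N` is an equivalent norm on `X`. -/
def IsEquivalentNorm {X : Type*} [NormedAddCommGroup X] [NormedSpace ℝ X]
    (N : Seminorm ℝ X) : Prop :=
  ∃ c C : ℝ, 0 < c ∧ 0 < C ∧ ∀ x : X, c * ‖x‖ ≤ N x ∧ N x ≤ C * ‖x‖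

/-- The Banach space `ℓ₁` of absolutely summable real sequences indexed by `ℕ`. -/
abbrev EllOne : Type := lp (fun _ : ℕ => ℝ) 1

/-- The unit vector basis of `ℓ₁`. -/
noncomputable def ellOneBasis (i : ℕ) : EllOne := lp.single 1 i (1 : ℝ)

/-- `X` contains an isomorph of `ℓ₁`: some linear subspace of `X` is linearly homeomorphic
to `ℓ₁` (such a subspace is automatically closed). -/
def ContainsEllOne (X : Type*) [NormedAddCommGroup X] [NormedSpace ℝ X] : Prop :=
  ∃ Y : Submodule ℝ X, Nonempty (EllOne ≃L[ℝ] Y)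

/-- `y` is a block basis of `b`: the vectors `y k` are non-zero and of the form
`∑_{p k ≤ l < p (k+1)} a l • b l` for integers `p 0 < p 1 < ...`. -/
def IsBlockBasis {X : Type*} [AddCommGroup X] [Module ℝ X] (b y : ℕ → X) : Prop :=
  ∃ (p : ℕ → ℕ) (a : ℕ → ℝ), StrictMono p ∧
    ∀ k, y k ≠ 0 ∧ y k = ∑ l ∈ Finset.Ico (p k) (p (k + 1)), a l • b l

/-- The same for a finite sequence `y 0, ..., y (m - 1)`. -/
def IsFiniteBlockBasis {X : Type*} [AddCommGroup X] [Module ℝ X] (b : ℕ → X) {m : ℕ}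
    (y : Fin m → X) : Prop :=
  ∃ (p : ℕ → ℕ) (a : ℕ → ℝ), StrictMono p ∧
    ∀ k : Fin m, y k ≠ 0 ∧
      y k = ∑ l ∈ Finset.Ico (p (k : ℕ)) (p ((k : ℕ) + 1)), a l • b l

/-- `lim_{m → ∞} lim_{n → ∞} f m n = L`, all the limits involved being required to exist. -/
def HasIteratedLimit (f : ℕ → ℕ → ℝ) (L : ℝ) : Prop :=
  ∃ g : ℕ → ℝ, (∀ m, Tendsto (f m) atTop (𝓝 (g m))) ∧ Tendsto g atTop (𝓝 L)

/-- The sequence `x` is basic with constant (at most) `K`, with respect to the norm `N`. -/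
def IsBasicSeq {X : Type*} [AddCommGroup X] [Module ℝ X] (N : Seminorm ℝ X) (K : ℝ)
    (x : ℕ → X) : Prop :=
  (∀ i, x i ≠ 0) ∧ ∀ (n m : ℕ), n ≤ m → ∀ a : ℕ → ℝ,
    N (∑ i ∈ Finset.range n, a i • x i) ≤ K * N (∑ i ∈ Finset.range m, a i • x i)

/-- The finite sequence `x 0, ..., x (m - 1)` is basic with constant (at most) `K`, with respect
to the norm `N`. -/
def IsFiniteBasicSeq {X : Type*} [AddCommGroup X] [Module ℝ X] (N : Seminorm ℝ X) (K : ℝ)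
    {m : ℕ} (x : Fin m → X) : Prop :=
  (∀ i, x i ≠ 0) ∧ ∀ n : ℕ, n ≤ m → ∀ a : Fin m → ℝ,
    N (∑ i : Fin m with i.val < n, a i • x i) ≤ K * N (∑ i, a i • x i)

/-- `m ≤ i 0 < i 1 < ... < i (m - 1)`. -/
def IsAdmissible {m : ℕ} (i : Fin m → ℕ) : Prop :=
  StrictMono i ∧ ∀ j, m ≤ i j

/-- `x` is a `K`-basic array with respect to the norm `N`; `x n i` is the `i`-th entry of the
`n`-th row. -/
structure IsKBasicArray {X : Type*} [AddCommGroup X] [Module ℝ X] (N : Seminorm ℝ X) (K : ℝ)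
    (x : ℕ → ℕ → X) : Prop where
  normalized : ∀ n i, N (x n i) = 1
  row_basic : ∀ n, IsBasicSeq N K (x n)
  diagonal_basic : ∀ (m : ℕ) (i : Fin m → ℕ), IsAdmissible i →
    IsFiniteBasicSeq N K (fun j : Fin m => x (j : ℕ) (i j))

/-- `x` is a basic array with respect to the norm `N`. -/
def IsBasicArray {X : Type*} [AddCommGroup X] [Module ℝ X] (N : Seminorm ℝ X)
    (x : ℕ → ℕ → X) : Prop :=
  ∃ K : ℝ, IsKBasicArray N K x

/-- `x` is a block basic array, with respect to the norm `N` and the basis `b`. -/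
structure IsBlockBasicArray {X : Type*} [AddCommGroup X] [Module ℝ X] (N : Seminorm ℝ X)
    (b : ℕ → X) (x : ℕ → ℕ → X) : Prop where
  basic : IsBasicArray N x
  row_block : ∀ n, IsBlockBasis b (x n)
  diagonal_block : ∀ (m : ℕ) (i : Fin m → ℕ), IsAdmissible i →
    IsFiniteBlockBasis b (fun j : Fin m => x (j : ℕ) (i j))

/-- The sequence `e` in the Banach space `E` is the asymptotic model of `(X, N)` generated by
the basic array `y`.

The field `stable` is the condition on a basic array under which it generates an asymptotic model:
for some `ε n ↓ 0`, the norms of the combinations `∑_{j < n} a j • y j (i j)` with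
`n ≤ i 0 < ... < i (n - 1)` and `|a j| ≤ 1` depend on the indices `i` only up to `ε n`.
Under `stable`, for each `n` and `a` these norms converge as `i 0 < ... < i (n - 1)` tend to
infinity together, and the iterated limit `lim_{i 0} ... lim_{i (n - 1)}` is this limit. The field
`norm_eq` says that it is the norm of `∑_{j < n} a j • e j`, and `dense_span` that `E` is the
completion of the span of the `e j`. -/
structure GeneratesAsymptoticModel {X : Type*} [AddCommGroup X] [Module ℝ X] (N : Seminorm ℝ X)
    (y : ℕ → ℕ → X) {E : Type*} [NormedAddCommGroup E] [NormedSpace ℝ E] [CompleteSpace E]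
    (e : ℕ → E) : Prop where
  basic : IsBasicArray N y
  stable : ∃ ε : ℕ → ℝ, (∀ n, 0 < ε n) ∧ Antitone ε ∧ Tendsto ε atTop (𝓝 0) ∧
    ∀ (n : ℕ) (a : Fin n → ℝ), (∀ j, |a j| ≤ 1) →
      ∀ i l : Fin n → ℕ, IsAdmissible i → IsAdmissible l →
        |N (∑ j : Fin n, a j • y (j : ℕ) (i j)) - N (∑ j : Fin n, a j • y (j : ℕ) (l j))| < ε n
  norm_eq : ∀ (n : ℕ) (a : Fin n → ℝ), ∀ δ > 0, ∃ M : ℕ,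
    ∀ i : Fin n → ℕ, StrictMono i → (∀ j, M ≤ i j) →
      |N (∑ j : Fin n, a j • y (j : ℕ) (i j)) - ‖∑ j : Fin n, a j • e (j : ℕ)‖| < δ
  dense_span : (Submodule.span ℝ (Set.range e)).topologicalClosure = ⊤

/-- The sequences `x` and `y` are `C`-equivalent. -/
def AreEquivalentSeqs {E F : Type*} [NormedAddCommGroup E] [NormedSpace ℝ E]
    [NormedAddCommGroup F] [NormedSpace ℝ F] (C : ℝ) (x : ℕ → E) (y : ℕ → F) : Prop :=
  ∃ A B : ℝ, 0 < A ∧ 0 < B ∧ A * B ≤ C ∧ ∀ (n : ℕ) (a : ℕ → ℝ),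
    A⁻¹ * ‖∑ i ∈ Finset.range n, a i • x i‖ ≤ ‖∑ i ∈ Finset.range n, a i • y i‖ ∧
    ‖∑ i ∈ Finset.range n, a i • y i‖ ≤ B * ‖∑ i ∈ Finset.range n, a i • x i‖

/-! ### Limits along ultrafilters and iterated limits -/

section UltrafilterLimits

/-! A Schauder basis makes `X` separable; let `d k` be dense. Add to the norm a convergent weighted
sum of the seminorms `y ↦ ‖‖y‖ d k + y‖ + ‖‖y‖ d k - y‖` (`exists_equivalentNorm_defect_le`). If `N
(x m ± y n) → 2` for normalized sequences, the triangle inequality is asymptotically an equality for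
`N`, hence for every summand. With `α`, `β` the limits of `‖x m‖`, `‖y n‖` along an ultrafilter,
density gives `‖α z + x m‖ + ‖β z ± y n‖ - ‖(α + β) z + x m ± y n‖ → 0` for every `z`.

Rescale to `u = x / α`, `w = y / β` and pass to the types `T (z, t) = lim ‖z + t u m‖`, `S (z, t) =
lim ‖z + t w n‖` and the iterated limit `W (z, s, t)` of `‖z + s u m + t w n‖`. With `p = α / (α +
β)` and `q = 1 - p`, this reads `p T (z, 1) + q S (z, ±1) = W (z, p, ±q)`. Convexity then forces `S
= T` and `T (z, |s| + |t|) ≤ W (z, s, t)` (`IsAdditiveAmalgam.symmetric`). Thus vectors `u m` can be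
chosen inductively with little loss in an `ℓ₁` lower estimate (`exists_ellOne_subfamily`), and they
span a copy of `ℓ₁`.

For asymptotic models, `1`-equivalence to the `ℓ₁` basis gives `‖e 0 ± e 1‖ = 2`, so the first two
rows of the array form such a pair of sequences. -/

theorem Ultrafilter.exists_tendsto_of_abs_le {ι : Type*} (U : Ultrafilter ι) {f : ι → ℝ} {C : ℝ}
    (hf : ∀ i, |f i| ≤ C) : ∃ l, Tendsto f U (𝓝 l) := by
  obtain ⟨l, -, hl⟩ := (isCompact_Icc (a := -C) (b := C)).ultrafilter_le_nhds (U.map f)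
    (by
      rw [le_principal_iff]
      exact Filter.mem_map.mpr (Filter.univ_mem' fun i => abs_le.mp (hf i)))
  exact ⟨l, hl⟩

theorem exists_seminorm_tendsto {ι V : Type*} [AddCommGroup V] [Module ℝ V] (U : Ultrafilter ι)
    (p : ι → Seminorm ℝ V) (hp : ∀ v, ∃ C, ∀ i, p i v ≤ C) :
    ∃ T : Seminorm ℝ V, ∀ v, Tendsto (fun i => p i v) U (𝓝 (T v)) := by
  have key : ∀ v, ∃ l, Tendsto (fun i => p i v) U (𝓝 l) := fun v => by
    obtain ⟨C, hC⟩ := hp v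
    exact U.exists_tendsto_of_abs_le (C := C) fun i => by
      rw [abs_of_nonneg (apply_nonneg (p i) v)]; exact hC i
  choose T hT using key
  refine ⟨Seminorm.of T (fun x y => ?_) (fun c x => ?_), hT⟩
  · exact le_of_tendsto_of_tendsto' (hT (x + y)) ((hT x).add (hT y))
      fun i => map_add_le_add (p i) x y
  · refine tendsto_nhds_unique (hT (c • x)) (((hT x).const_mul ‖c‖).congr fun i => ?_)
    exact (map_smul_eq_mul (p i) c x).symm

/-- Encoding an iterated limit as one limit along `l.curry l'` permits squeezing and algebra on
expressions in both indices at once. -/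
theorem tendsto_curry_of_tendsto {ι κ : Type*} {l : Filter ι} {l' : Filter κ} {f : ι → κ → ℝ}
    {g : ι → ℝ} {L : ℝ} (hf : ∀ m, Tendsto (f m) l' (𝓝 (g m))) (hg : Tendsto g l (𝓝 L)) :
    Tendsto (fun z : ι × κ => f z.1 z.2) (l.curry l') (𝓝 L) := by
  rw [Metric.tendsto_nhds]
  intro ε hε
  rw [eventually_curry_iff]
  filter_upwards [Metric.tendsto_nhds.mp hg (ε / 2) (half_pos hε)] with m hm
  filter_upwards [Metric.tendsto_nhds.mp (hf m) (ε / 2) (half_pos hε)] with n hn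
  calc dist (f m n) L ≤ dist (f m n) (g m) + dist (g m) L := dist_triangle _ _ _
    _ < ε := by linarith

end UltrafilterLimits

/-! ### Types attaining the triangle inequality -/

section TypeAlgebra

/-- If `p τ(r) + q σ(r) ≤ p τ(r + q h) + q σ(r - p h)` for all `r` and `h`, and `σ` is convex,
then `σ` grows at most as fast as `τ`. -/
theorem sub_le_sub_of_infConvolution {τ σ : ℝ → ℝ} {p q : ℝ} (hp : 0 < p) (hq : 0 < q)
    (hσ : ConvexOn ℝ Set.univ σ) (hc : Continuous σ)
    (H : ∀ r h, p * τ r + q * σ r ≤ p * τ (r + q * h) + q * σ (r - p * h)) :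
    σ 1 - σ 0 ≤ τ 1 - τ 0 := by
  -- The choice `h = d / q` moves `τ` by `d` and `σ` by `p / q * d`. Convexity replaces the slope of
  -- `σ` ending at `r` by the smaller slope on the preceding interval of length `d`, so that
  -- increments of equal length are compared and the sum telescopes.
  have step : ∀ d > 0, ∀ r,
      σ (r - p / q * d) - σ (r - p / q * d - d) ≤ τ (r + d) - τ r := by
    intro d hd r
    have h1 := H r (d / q)
    have e1 : q * (d / q) = d := by field_simp
    have e2 : p * (d / q) = p / q * d := by field_simp
    rw [e1, e2] at h1
    have hpos : 0 < p / q * d := by positivity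
    have h2 := hσ.slope_mono_adjacent (Set.mem_univ (r - p / q * d - d)) (Set.mem_univ r)
      (y := r - p / q * d) (by linarith) (by linarith)
    rw [show r - p / q * d - (r - p / q * d - d) = d by ring,
      show r - (r - p / q * d) = p / q * d by ring, div_le_div_iff₀ hd hpos] at h2
    have h3 : (σ (r - p / q * d) - σ (r - p / q * d - d)) * p ≤
        q * (σ r - σ (r - p / q * d)) := by
      have : (σ (r - p / q * d) - σ (r - p / q * d - d)) * p * d ≤
          q * (σ r - σ (r - p / q * d)) * d := by
        calc _ = q * ((σ (r - p / q * d) - σ (r - p / q * d - d)) * (p / q * d)) := by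
              field_simp
          _ ≤ q * ((σ r - σ (r - p / q * d)) * d) := by gcongr
          _ = _ := by ring
      exact le_of_mul_le_mul_right this hd
    have h4 : p * (σ (r - p / q * d) - σ (r - p / q * d - d)) ≤ p * (τ (r + d) - τ r) := by
      linarith
    exact le_of_mul_le_mul_left h4 hp
  have tel : ∀ d > 0, ∀ n : ℕ,
      σ (n * d - p / q * d - d) - σ (-(p / q * d) - d) ≤ τ (n * d) - τ 0 := by
    intro d hd n
    induction n with
    | zero => simp
    | succ n ih =>
      have h := step d hd (n * d)
      rw [show (n : ℝ) * d + d = ((n + 1 : ℕ) : ℝ) * d by push_cast; ring] at h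
      rw [show ((n + 1 : ℕ) : ℝ) * d - p / q * d - d = n * d - p / q * d by push_cast; ring]
      linarith
  -- With `n + 1` steps of length `1 / (n + 1)`, the left shift of the interval for `σ` tends to `0`
  -- and disappears by continuity.
  have lim : Tendsto (fun n : ℕ => σ (1 - p / q * (1 / ((n : ℝ) + 1)) - 1 / ((n : ℝ) + 1)) -
      σ (-(p / q * (1 / ((n : ℝ) + 1))) - 1 / ((n : ℝ) + 1))) atTop (𝓝 (σ 1 - σ 0)) := by
    have h0 := tendsto_one_div_add_atTop_nhds_zero_nat (𝕜 := ℝ)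
    have hc1 : Tendsto (fun d : ℝ => σ (1 - p / q * d - d) - σ (-(p / q * d) - d)) (𝓝 0)
        (𝓝 (σ 1 - σ 0)) := by
      have : Continuous fun d : ℝ => σ (1 - p / q * d - d) - σ (-(p / q * d) - d) := by fun_prop
      simpa using this.tendsto 0
    exact hc1.comp h0
  refine le_of_tendsto' lim fun n => ?_
  have h := tel (1 / ((n : ℝ) + 1)) (by positivity) (n + 1)
  have e : ((n + 1 : ℕ) : ℝ) * (1 / ((n : ℝ) + 1)) = 1 := by
    push_cast; field_simp
  rwa [e] at h

variable {X : Type*} [NormedAddCommGroup X] [NormedSpace ℝ X]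

theorem Seminorm.le_add_norm_of_prod {T : Seminorm ℝ (X × ℝ)} (h0 : ∀ x, T (x, 0) = ‖x‖)
    (x y : X) (t : ℝ) : T (x, t) ≤ T (y, t) + ‖x - y‖ := by
  have h := map_add_le_add T (y, t) (x - y, 0)
  simpa [h0] using h

theorem Seminorm.continuous_line_of_prod {T : Seminorm ℝ (X × ℝ)} (h0 : ∀ x, T (x, 0) = ‖x‖)
    (x : X) : Continuous fun r : ℝ => T (r • x, 1) := by
  have : LipschitzWith ‖x‖₊ fun r : ℝ => T (r • x, 1) := by
    refine LipschitzWith.of_le_add_mul _ fun r s => ?_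
    have h := Seminorm.le_add_norm_of_prod h0 (r • x) (s • x) 1
    rw [← sub_smul, norm_smul] at h
    simpa [Real.dist_eq, mul_comm] using h
  exact this.continuous

theorem Seminorm.convexOn_line_of_prod (T : Seminorm ℝ (X × ℝ)) (x : X) :
    ConvexOn ℝ Set.univ fun r : ℝ => T (r • x, 1) := by
  refine ⟨convex_univ, fun r _ s _ a b ha hb hab => ?_⟩
  have h := map_add_le_add T (a • (r • x, (1 : ℝ))) (b • (s • x, (1 : ℝ)))
  rw [map_smul_eq_mul, map_smul_eq_mul, Real.norm_of_nonneg ha, Real.norm_of_nonneg hb] at h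
  have e : a • (r • x, (1 : ℝ)) + b • (s • x, (1 : ℝ)) = ((a • r + b • s) • x, (1 : ℝ)) := by
    ext <;> simp [add_smul, mul_smul, hab]
  rwa [e] at h

/-- The joint norm `W` of two types `T` and `S` with parameters `p`, `q` attaining the triangle
inequality. -/
structure IsAdditiveAmalgam (T S : Seminorm ℝ (X × ℝ)) (W : Seminorm ℝ (X × ℝ × ℝ))
    (p q : ℝ) : Prop where
  left_zero : ∀ x, T (x, 0) = ‖x‖
  right_zero : ∀ x, S (x, 0) = ‖x‖
  left_one : T (0, 1) = 1
  right_one : S (0, 1) = 1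
  amalgam_left : ∀ x s, W (x, s, 0) = T (x, s)
  amalgam_right : ∀ x t, W (x, 0, t) = S (x, t)
  pos_left : 0 < p
  pos_right : 0 < q
  sum_eq : p + q = 1
  additive : ∀ x, p * T (x, 1) + q * S (x, 1) ≤ W (x, p, q)

namespace IsAdditiveAmalgam

variable {T S : Seminorm ℝ (X × ℝ)} {W : Seminorm ℝ (X × ℝ × ℝ)} {p q : ℝ}

theorem infConvolution (h : IsAdditiveAmalgam T S W p q) (x y z : X) (hx : x = p • y + q • z) :
    p * T (x, 1) + q * S (x, 1) ≤ p * T (y, 1) + q * S (z, 1) := by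
  have h1 := map_add_le_add W (p • (y, (1 : ℝ), (0 : ℝ))) (q • (z, (0 : ℝ), (1 : ℝ)))
  rw [map_smul_eq_mul, map_smul_eq_mul, Real.norm_of_nonneg h.pos_left.le,
    Real.norm_of_nonneg h.pos_right.le, h.amalgam_left, h.amalgam_right] at h1
  have e : p • (y, (1 : ℝ), (0 : ℝ)) + q • (z, (0 : ℝ), (1 : ℝ)) = (x, p, q) := by
    ext <;> simp [hx]
  rw [e] at h1
  exact (h.additive x).trans h1

/-- On each line `r ↦ r • x`, the inf-convolution inequality compares the increments of the two
convex functions in both directions. The increments from `0` to `1` agree, and both functions equal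
`1` at `0`. -/
theorem eq_one (h : IsAdditiveAmalgam T S W p q) (x : X) : T (x, 1) = S (x, 1) := by
  have hpq := h.sum_eq
  have h1 := sub_le_sub_of_infConvolution (τ := fun r => T (r • x, 1))
    (σ := fun r => S (r • x, 1)) h.pos_left h.pos_right (S.convexOn_line_of_prod x)
    (Seminorm.continuous_line_of_prod h.right_zero x) fun r d => by
      refine h.infConvolution _ _ _ ?_
      rw [smul_smul, smul_smul, ← add_smul]
      congr 1
      linear_combination (-r) * hpq
  have h2 := sub_le_sub_of_infConvolution (τ := fun r => S (r • x, 1))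
    (σ := fun r => T (r • x, 1)) h.pos_right h.pos_left (T.convexOn_line_of_prod x)
    (Seminorm.continuous_line_of_prod h.left_zero x) fun r d => by
      have := h.infConvolution (r • x) ((r - q * d) • x) ((r + p * d) • x) (by
        rw [smul_smul, smul_smul, ← add_smul]
        congr 1
        linear_combination (-r) * hpq)
      linarith
  simp only [one_smul, zero_smul, h.left_one, h.right_one] at h1 h2
  linarith

theorem left_smul_one (T : Seminorm ℝ (X × ℝ)) {r : ℝ} (hr : 0 < r) (x : X) :
    r * T (r⁻¹ • x, 1) = T (x, r) := by
  have := map_smul_eq_mul T r (r⁻¹ • x, (1 : ℝ))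
  rw [Real.norm_of_nonneg hr.le] at this
  rw [← this]
  simp [smul_smul, hr.ne']

/-- Along the ray in proportion `p : q` the bound is the additivity hypothesis together with `T = S`
at height `1`. Any other `(x, s, t)` is moved onto that ray by raising its deficient coordinate, and
the triangle inequality charges exactly the height that was added. -/
theorem le_amalgam (h : IsAdditiveAmalgam T S W p q) (x : X) {s t : ℝ} (hs : 0 ≤ s)
    (ht : 0 ≤ t) : T (x, s + t) ≤ W (x, s, t) := by
  have hp := h.pos_left
  have hq := h.pos_right
  have hpq := h.sum_eq
  rcases (add_nonneg hs ht).eq_or_lt with h0 | hr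
  · have hs0 : s = 0 := by linarith
    have ht0 : t = 0 := by linarith
    simp [hs0, ht0, h.amalgam_left]
  set y := (s + t)⁻¹ • x with hy
  have hx : x = (s + t) • y := by rw [hy, smul_smul, mul_inv_cancel₀ hr.ne', one_smul]
  rw [← left_smul_one T hr, ← hy]
  have hadd := h.additive y
  rw [← h.eq_one y, ← add_mul, hpq, one_mul] at hadd
  have scale : ∀ c : ℝ, 0 ≤ c → c * T (y, 1) ≤ W (c • (y, p, q)) := fun c hc => by
    rw [map_smul_eq_mul, Real.norm_of_nonneg hc]
    exact mul_le_mul_of_nonneg_left hadd hc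
  rcases le_total (t / q) (s / p) with hle | hle
  · have hc : 0 ≤ s / p * q - t := by
      rw [div_le_iff₀ hq] at hle; linarith
    have h1 := scale (s / p) (by positivity)
    have h2 := map_add_le_add W (x, s, t) ((s / p * q - t) • (y, (0 : ℝ), (1 : ℝ)))
    rw [map_smul_eq_mul, Real.norm_of_nonneg hc, h.amalgam_right, ← h.eq_one] at h2
    have hsp : s / p * p = s := by field_simp
    have e : (x, s, t) + (s / p * q - t) • (y, (0 : ℝ), (1 : ℝ)) = (s / p) • (y, p, q) := by
      ext
      · simp only [Prod.fst_add, Prod.smul_fst]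
        rw [hx, ← add_smul]
        congr 1
        linear_combination (s / p) * hpq - hsp
      · simp [hsp]
      · simp
    rw [e] at h2
    have e2 : s / p - (s / p * q - t) = s + t := by linear_combination (-(s / p)) * hpq + hsp
    rw [← e2, sub_mul]
    linarith
  · have hc : 0 ≤ t / q * p - s := by
      rw [div_le_iff₀ hp] at hle; linarith
    have h1 := scale (t / q) (by positivity)
    have h2 := map_add_le_add W (x, s, t) ((t / q * p - s) • (y, (1 : ℝ), (0 : ℝ)))
    rw [map_smul_eq_mul, Real.norm_of_nonneg hc, h.amalgam_left] at h2
    have htq : t / q * q = t := by field_simp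
    have e : (x, s, t) + (t / q * p - s) • (y, (1 : ℝ), (0 : ℝ)) = (t / q) • (y, p, q) := by
      ext
      · simp only [Prod.fst_add, Prod.smul_fst]
        rw [hx, ← add_smul]
        congr 1
        linear_combination (t / q) * hpq - htq
      · simp
      · simp [htq]
    rw [e] at h2
    have e2 : t / q - (t / q * p - s) = s + t := by linear_combination (-(t / q)) * hpq + htq
    rw [← e2, sub_mul]
    linarith

end IsAdditiveAmalgam

/-- Change of sign of the last coordinate in `X × ℝ`. -/
def flipSnd (X : Type*) [AddCommGroup X] [Module ℝ X] : X × ℝ →ₗ[ℝ] X × ℝ :=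
  LinearMap.prodMap LinearMap.id (-LinearMap.id)

@[simp]
theorem flipSnd_apply (x : X) (t : ℝ) : flipSnd X (x, t) = (x, -t) := rfl

/-- Change of sign of the last coordinate in `X × ℝ × ℝ`. -/
def flipLast (X : Type*) [AddCommGroup X] [Module ℝ X] : X × ℝ × ℝ →ₗ[ℝ] X × ℝ × ℝ :=
  LinearMap.prodMap LinearMap.id (flipSnd ℝ)

@[simp]
theorem flipLast_apply (x : X) (s t : ℝ) : flipLast X (x, s, t) = (x, s, -t) := rfl

variable {T S : Seminorm ℝ (X × ℝ)} {W : Seminorm ℝ (X × ℝ × ℝ)} {p q : ℝ}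

theorem IsAdditiveAmalgam.symmetric (h : IsAdditiveAmalgam T S W p q)
    (h' : IsAdditiveAmalgam T (S.comp (flipSnd X)) (W.comp (flipLast X)) p q) :
    (∀ x t, S (x, t) = T (x, t)) ∧ ∀ x s t, T (x, |s| + |t|) ≤ W (x, s, t) := by
  have hpos : ∀ x t, 0 < t → S (x, t) = T (x, t) := fun x t ht => by
    rw [← left_smul_one S ht, ← h.eq_one, left_smul_one T ht]
  have hneg : ∀ x t, 0 < t → S (x, -t) = T (x, t) := fun x t ht => by
    have := h'.eq_one (t⁻¹ • x)
    rw [← left_smul_one T ht, this,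
      left_smul_one (S.comp (flipSnd X)) ht, Seminorm.comp_apply, flipSnd_apply]
  have hflip : ∀ x t, T (-x, t) = T (x, -t) := fun x t => by
    simpa using map_neg_eq_map T (x, -t)
  -- For `t > 0`: `T (x, -t) = T (-x, t) = S (-x, t) = S (x, -t) = T (x, t)`.
  have heven : ∀ x t, T (x, -t) = T (x, t) := by
    have : ∀ x t, 0 < t → T (x, -t) = T (x, t) := fun x t ht => by
      rw [← hflip, ← hpos _ _ ht, ← hneg _ _ ht]
      simpa using map_neg_eq_map S (x, -t)
    intro x t
    rcases lt_trichotomy t 0 with ht | rfl | ht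
    · simpa using (this x (-t) (by linarith)).symm
    · simp
    · exact this x t ht
  have hS : ∀ x t, S (x, t) = T (x, t) := by
    intro x t
    rcases lt_trichotomy t 0 with ht | rfl | ht
    · have := hneg x (-t) (by linarith)
      rwa [neg_neg, heven] at this
    · rw [h.left_zero, h.right_zero]
    · exact hpos x t ht
  refine ⟨hS, ?_⟩
  have nonneg : ∀ x s t, 0 ≤ s → T (x, |s| + |t|) ≤ W (x, s, t) := by
    intro x s t hs
    rw [abs_of_nonneg hs]
    rcases le_total 0 t with ht | ht
    · rw [abs_of_nonneg ht]; exact h.le_amalgam x hs ht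
    · rw [abs_of_nonpos ht]
      simpa using h'.le_amalgam x hs (neg_nonneg.mpr ht)
  intro x s t
  rcases le_total 0 s with hs | hs
  · exact nonneg x s t hs
  · have h1 := nonneg (-x) (-s) (-t) (by linarith)
    rw [abs_neg, abs_neg, hflip, heven] at h1
    have h2 : W (-x, -s, -t) = W (x, s, t) := by simpa using map_neg_eq_map W (x, s, t)
    rwa [h2] at h1

end TypeAlgebra

/-! ### Inductive selection of an `ℓ₁` sequence -/

section EllOneSequences

/-- On a finite-dimensional space, seminorms converging pointwise to a seminorm that dominates the
norm eventually almost dominate the norm. -/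
theorem eventually_forall_le_seminorm {ι E : Type*} [NormedAddCommGroup E] [NormedSpace ℝ E]
    [FiniteDimensional ℝ E] {l : Filter ι} {p : ι → Seminorm ℝ E} {P : Seminorm ℝ E} {C θ θ' : ℝ}
    (hC : ∀ i z, p i z ≤ C * ‖z‖) (hlim : ∀ z, Tendsto (fun i => p i z) l (𝓝 (P z)))
    (hP : ∀ z, θ * ‖z‖ ≤ P z) (hθ : θ' < θ) : ∀ᶠ i in l, ∀ z, θ' * ‖z‖ ≤ p i z := by
  have hK : IsCompact (Metric.sphere (0 : E) 1) := isCompact_sphere _ _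
  -- The common bound `C` makes the `p i` equi-Lipschitz, so a lower bound at `y` survives near `y`;
  -- compactness of the sphere makes it uniform. The factor `|C| + 1` avoids a sign assumption on
  -- `C`.
  have key := hK.mem_prod_nhdsSet_of_forall (l := l) (s := {w : ι × E | θ' < p w.1 w.2})
    fun y hy => by
      have hy1 : ‖y‖ = 1 := by simpa using hy
      have hPy : θ ≤ P y := by simpa [hy1] using hP y
      have h1 : ∀ᶠ i in l, (θ + θ') / 2 < p i y :=
        (hlim y).eventually_const_lt (by linarith)
      have h2 : ∀ᶠ z in 𝓝 y, (|C| + 1) * ‖y - z‖ < (θ - θ') / 2 := by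
        have : Tendsto (fun z => (|C| + 1) * ‖y - z‖) (𝓝 y) (𝓝 ((|C| + 1) * ‖y - y‖)) :=
          (by fun_prop : Continuous fun z => (|C| + 1) * ‖y - z‖).tendsto y
        refine this.eventually_lt_const ?_
        simp only [sub_self, norm_zero, mul_zero]
        linarith
      filter_upwards [h1.prod_mk h2] with w hw
      have h3 := map_add_le_add (p w.1) w.2 (y - w.2)
      rw [add_sub_cancel] at h3
      have h4 := hC w.1 (y - w.2)
      have h5 : C * ‖y - w.2‖ ≤ (|C| + 1) * ‖y - w.2‖ := by
        gcongr; linarith [le_abs_self C]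
      show θ' < p w.1 w.2
      linarith [hw.1, hw.2]
  have hev : ∀ᶠ w in l ×ˢ 𝓝ˢ (Metric.sphere (0 : E) 1), θ' < p w.1 w.2 := key
  filter_upwards [hev.curry] with i hi z
  rcases eq_or_ne z 0 with rfl | hz
  · simp
  · have hz' : 0 < ‖z‖ := norm_pos_iff.mpr hz
    have hmem : ‖z‖⁻¹ • z ∈ Metric.sphere (0 : E) 1 := by
      simp [norm_smul, hz'.ne']
    have := subset_of_mem_nhdsSet hi hmem
    simp only [Set.mem_ofPred_eq, map_smul_eq_mul, norm_inv, norm_norm] at this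
    rw [inv_mul_eq_div, lt_div_iff₀ hz'] at this
    exact this.le

variable {X : Type*} [NormedAddCommGroup X] [NormedSpace ℝ X]

/-- The map `(x, t) ↦ x + t • w`. -/
def addSmul (w : X) : X × ℝ →ₗ[ℝ] X :=
  LinearMap.coprod LinearMap.id (LinearMap.toSpanSingleton ℝ X w)

@[simp]
theorem addSmul_apply (w x : X) (t : ℝ) : addSmul w (x, t) = x + t • w := by
  simp [addSmul]

/-- The map `(x, s, t) ↦ (x + s • w, t)`. -/
def addSmulPair (w : X) : X × ℝ × ℝ →ₗ[ℝ] X × ℝ :=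
  ((addSmul w).comp ((LinearMap.fst ℝ X (ℝ × ℝ)).prod
    ((LinearMap.fst ℝ ℝ ℝ).comp (LinearMap.snd ℝ X (ℝ × ℝ))))).prod
    ((LinearMap.snd ℝ ℝ ℝ).comp (LinearMap.snd ℝ X (ℝ × ℝ)))

@[simp]
theorem addSmulPair_apply (w x : X) (s t : ℝ) : addSmulPair w (x, s, t) = (x + s • w, t) := by
  simp [addSmulPair]

theorem Seminorm.le_norm_add_abs {T : Seminorm ℝ (X × ℝ)} (h0 : ∀ x, T (x, 0) = ‖x‖)
    (h1 : T (0, 1) = 1) (x : X) (t : ℝ) : T (x, t) ≤ ‖x‖ + |t| := by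
  have h := map_add_le_add T (x, 0) (t • ((0 : X), (1 : ℝ)))
  rw [map_smul_eq_mul, h0, h1] at h
  simpa using h

/-- The finite-dimensional space `ℓ₁ᵏ ⊕₁ (ℝ ⊕₁ ℝ)`. -/
abbrev EllOnePair (k : ℕ) : Type :=
  WithLp 1 (PiLp 1 (fun _ : Fin k => ℝ) × WithLp 1 (ℝ × ℝ))

/-- The estimate for `T` at height `|s| + |t|` passes to `W`, which is the limit of `T` after adding
`s • u i`. Finite-dimensional compactness realizes it at a single index, at the cost of lowering `θ`
to `θ'`. -/
theorem exists_extension_of_type {ι : Type*} {l : Filter ι} [l.NeBot] {u : ι → X} {C : ℝ}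
    (hu : ∀ i, ‖u i‖ ≤ C)
    {T : Seminorm ℝ (X × ℝ)} (h0 : ∀ x, T (x, 0) = ‖x‖) (h1 : T (0, 1) = 1)
    {W : Seminorm ℝ (X × ℝ × ℝ)} (hW : ∀ z, Tendsto (fun i => T (addSmulPair (u i) z)) l (𝓝 (W z)))
    (hTW : ∀ x s t, T (x, |s| + |t|) ≤ W (x, s, t)) {k : ℕ} (w : Fin k → X) {θ θ' : ℝ}
    (hθ : ∀ (a : Fin k → ℝ) t, θ * (∑ i, |a i| + |t|) ≤ T (∑ i, a i • w i, t))
    (hlt : θ' < θ) :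
    ∃ m, ∀ (a : Fin k → ℝ) s t,
      θ' * (∑ i, |a i| + |s| + |t|) ≤ T (∑ i, a i • w i + s • u m, t) := by
  let L : EllOnePair k →ₗ[ℝ] X × ℝ × ℝ :=
    { toFun := fun z => (∑ i, z.fst i • w i, z.snd.fst, z.snd.snd)
      map_add' := fun z z' => by
        ext <;> simp [add_smul, Finset.sum_add_distrib]
      map_smul' := fun c z => by
        ext <;> simp [mul_smul, Finset.smul_sum] }
  have hnorm : ∀ z : EllOnePair k, ‖z‖ = ∑ i, |z.fst i| + (|z.snd.fst| + |z.snd.snd|) := fun z => by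
    simp [WithLp.prod_norm_eq_of_L1, PiLp.norm_eq_of_L1]
  have hC0 : 0 ≤ C := by
    obtain ⟨i⟩ := l.nonempty_of_neBot
    exact (norm_nonneg _).trans (hu i)
  have hw0 : 0 ≤ ∑ i, ‖w i‖ := Finset.sum_nonneg fun i _ => norm_nonneg _
  have := eventually_forall_le_seminorm (l := l) (E := EllOnePair k)
    (p := fun i => T.comp ((addSmulPair (u i)).comp L)) (P := W.comp L)
    (C := ∑ i, ‖w i‖ + C + 1) (θ := θ) (θ' := θ') (fun m z => ?_) (fun z => hW (L z)) (fun z => ?_)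
    hlt
  · obtain ⟨m, hm⟩ := this.exists
    refine ⟨m, fun a s t => ?_⟩
    have h := hm (WithLp.toLp 1 (WithLp.toLp 1 a, WithLp.toLp 1 (s, t)))
    rw [hnorm] at h
    simpa [L, add_assoc] using h
  · have e : (T.comp ((addSmulPair (u m)).comp L)) z =
        T (∑ i, z.fst i • w i + z.snd.fst • u m, z.snd.snd) := by simp [L]
    rw [e]
    refine (Seminorm.le_norm_add_abs h0 h1 _ _).trans ?_
    have b1 : ‖∑ i, z.fst i • w i‖ ≤ (∑ i, ‖w i‖) * ∑ i, |z.fst i| := by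
      refine (norm_sum_le _ _).trans ?_
      rw [Finset.mul_sum]
      refine Finset.sum_le_sum fun i _ => ?_
      rw [norm_smul, Real.norm_eq_abs, mul_comm]
      gcongr
      exact Finset.single_le_sum (f := fun i => ‖w i‖) (fun i _ => norm_nonneg _)
        (Finset.mem_univ i)
    have b2 : ‖z.snd.fst • u m‖ ≤ C * |z.snd.fst| := by
      rw [norm_smul, Real.norm_eq_abs, mul_comm]
      gcongr
      exact hu m
    have b3 := norm_add_le (∑ i, z.fst i • w i) (z.snd.fst • u m)
    rw [hnorm]
    have c1 : 0 ≤ ∑ i, |z.fst i| := Finset.sum_nonneg fun i _ => abs_nonneg _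
    have c2 := abs_nonneg z.snd.fst
    have c3 := abs_nonneg z.snd.snd
    nlinarith [mul_nonneg hC0 c1, mul_nonneg hC0 c3, mul_nonneg hw0 c2, mul_nonneg hw0 c3]
  · have h := hTW (∑ i, z.fst i • w i) z.snd.fst z.snd.snd
    have h' := hθ z.fst (|z.snd.fst| + |z.snd.snd|)
    rw [abs_of_nonneg (by positivity : 0 ≤ |z.snd.fst| + |z.snd.snd|)] at h'
    rw [hnorm]
    exact h'.trans h

theorem exists_ellOne_subfamily {ι : Type*} {l : Filter ι} [l.NeBot] {u : ι → X} {C : ℝ}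
    (hu : ∀ i, ‖u i‖ ≤ C)
    {T : Seminorm ℝ (X × ℝ)} (h0 : ∀ x, T (x, 0) = ‖x‖) (h1 : T (0, 1) = 1)
    {W : Seminorm ℝ (X × ℝ × ℝ)} (hW : ∀ z, Tendsto (fun i => T (addSmulPair (u i) z)) l (𝓝 (W z)))
    (hTW : ∀ x s t, T (x, |s| + |t|) ≤ W (x, s, t)) (hT1 : ∀ t, T (0, t) = |t|) :
    ∃ φ : ℕ → ι, ∀ (n : ℕ) (a : ℕ → ℝ),
      1 / 2 * ∑ i ∈ Finset.range n, |a i| ≤ ‖∑ i ∈ Finset.range n, a i • u (φ i)‖ := by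
  -- Strictly decreasing from `θ 0 = 1` and always above `1 / 2`, which leaves room for a loss at
  -- every stage.
  let θ : ℕ → ℝ := fun k => 1 / 2 + (1 / 2) ^ (k + 1)
  have hθ : ∀ k, θ (k + 1) < θ k := fun k => by
    simp only [θ]
    have : (0 : ℝ) < (1 / 2) ^ (k + 1) := by positivity
    rw [pow_succ _ (k + 1)]
    linarith
  -- The coordinate `t` stands for a vector yet to be chosen; without it the induction could not
  -- continue.
  let Good : ℕ → (ℕ → ι) → Prop := fun k φ => ∀ (a : ℕ → ℝ) (t : ℝ),
    θ k * (∑ i ∈ Finset.range k, |a i| + |t|) ≤ T (∑ i ∈ Finset.range k, a i • u (φ i), t)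
  have step : ∀ k (φ : {φ // Good k φ}), ∃ ψ : {ψ // Good (k + 1) ψ},
      ∀ i < k, ψ.1 i = φ.1 i := by
    rintro k ⟨φ, hφ⟩
    obtain ⟨m, hm⟩ := exists_extension_of_type hu h0 h1 hW hTW (fun i : Fin k => u (φ i))
      (fun a t => by
        have := hφ (fun i => if h : i < k then a ⟨i, h⟩ else 0) t
        simpa [Finset.sum_range] using this) (hθ k)
    refine ⟨⟨Function.update φ k m, fun a t => ?_⟩, fun i hi => Function.update_of_ne hi.ne _ _⟩
    have := hm (fun i => a i) (a k) t
    have e : ∑ i ∈ Finset.range k, a i • u (Function.update φ k m i) =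
        ∑ i : Fin k, a i • u (φ i) := by
      rw [Finset.sum_range]
      refine Finset.sum_congr rfl fun i _ => ?_
      rw [Function.update_of_ne i.2.ne]
    rw [Finset.sum_range_succ, Finset.sum_range_succ, Function.update_self, e,
      Finset.sum_range (fun i => |a i|)]
    exact this
  obtain ⟨i₀⟩ := l.nonempty_of_neBot
  choose next hnext using step
  let seq : ∀ k, {φ // Good k φ} := fun k => Nat.rec
    ⟨fun _ => i₀, fun a t => by norm_num [θ, hT1]⟩ (fun k φ => next k φ) k
  -- Stage `k + 1` changes only the value at `k`, so the value at `i` is final from stage `i + 1`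
  -- on.
  have hseq : ∀ k i, i < k → (seq k).1 i = (seq (i + 1)).1 i := by
    intro k
    induction k with
    | zero => intro i hi; omega
    | succ k ih =>
      intro i hi
      rcases (Nat.lt_succ_iff.mp hi).eq_or_lt with rfl | hik
      · rfl
      · rw [← ih i hik]
        exact hnext k (seq k) i hik
  refine ⟨fun i => (seq (i + 1)).1 i, fun n a => ?_⟩
  have h := (seq n).2 a 0
  rw [h0, abs_zero, add_zero] at h
  have e : ∑ i ∈ Finset.range n, a i • u ((seq n).1 i) =
      ∑ i ∈ Finset.range n, a i • u ((seq (i + 1)).1 i) :=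
    Finset.sum_congr rfl fun i hi => by rw [hseq n i (Finset.mem_range.mp hi)]
  rw [e] at h
  refine le_trans ?_ h
  gcongr
  simp only [θ]
  have : (0 : ℝ) < (1 / 2) ^ (n + 1) := by positivity
  linarith

end EllOneSequences

/-! ### From lower `ℓ₁` estimates to an embedding -/

section Embedding

theorem EllOne.summable_abs (a : EllOne) : Summable fun i => |a i| := by
  simpa using (lp.memℓp a).summable (by simp)

theorem EllOne.norm_eq_tsum_abs (a : EllOne) : ‖a‖ = ∑' i, |a i| := by
  simpa using lp.norm_eq_tsum_rpow (by simp) a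

variable {X : Type*} [NormedAddCommGroup X] [NormedSpace ℝ X] [CompleteSpace X]

theorem containsEllOne_of_lower_bound {w : ℕ → X} {c C : ℝ} (hc : 0 < c) (hw : ∀ i, ‖w i‖ ≤ C)
    (h : ∀ (n : ℕ) (a : ℕ → ℝ),
      c * ∑ i ∈ Finset.range n, |a i| ≤ ‖∑ i ∈ Finset.range n, a i • w i‖) :
    ContainsEllOne X := by
  have hle : ∀ (a : EllOne) i, ‖a i • w i‖ ≤ |a i| * C := fun a i => by
    rw [norm_smul, Real.norm_eq_abs]
    gcongr
    exact hw i
  have hsn : ∀ a : EllOne, Summable fun i => ‖a i • w i‖ := fun a =>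
    Summable.of_nonneg_of_le (fun i => norm_nonneg _) (hle a) (a.summable_abs.mul_right C)
  have hs : ∀ a : EllOne, Summable fun i => a i • w i := fun a => (hsn a).of_norm
  let L : EllOne →ₗ[ℝ] X :=
    { toFun := fun a => ∑' i, a i • w i
      map_add' := fun a a' => by
        rw [← (hs a).tsum_add (hs a')]
        exact tsum_congr fun i => by simp [add_smul]
      map_smul' := fun r a => by
        rw [RingHom.id_apply, ← (hs a).tsum_const_smul]
        exact tsum_congr fun i => by simp [mul_smul] }
  let Φ : EllOne →L[ℝ] X := L.mkContinuous C fun a => by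
    rw [EllOne.norm_eq_tsum_abs, ← tsum_mul_left]
    refine (norm_tsum_le_tsum_norm (hsn a)).trans ?_
    refine (hsn a).tsum_le_tsum (fun i => ?_) (a.summable_abs.mul_left C)
    rw [mul_comm]
    exact hle a i
  have hlow : ∀ a, c * ‖a‖ ≤ ‖Φ a‖ := fun a => by
    rw [EllOne.norm_eq_tsum_abs]
    exact le_of_tendsto_of_tendsto' (a.summable_abs.hasSum.tendsto_sum_nat.const_mul c)
      (hs a).hasSum.tendsto_sum_nat.norm fun n => h n a
  have hanti : AntilipschitzWith (Real.toNNReal c⁻¹) Φ := by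
    refine Φ.antilipschitz_of_bound fun a => ?_
    rw [Real.coe_toNNReal _ (by positivity), inv_mul_eq_div, le_div_iff₀ hc, mul_comm]
    exact hlow a
  exact ⟨_, ⟨Φ.equivRange hanti.injective (hanti.isClosed_range Φ.uniformContinuous)⟩⟩

end Embedding

/-! ### The equivalent norm and its triangle defects -/

section Renorming

variable {X : Type*} [NormedAddCommGroup X] [NormedSpace ℝ X]

/-- As a function of `r` the sum is even and convex, hence increasing on `r ≥ 0`. This monotonicity
yields the triangle inequality for `symmetrizedSeminorm`. -/
theorem norm_smul_add_add_norm_smul_sub_mono (x z : X) {r s : ℝ} (hr : 0 ≤ r) (hrs : r ≤ s) :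
    ‖r • x + z‖ + ‖r • x - z‖ ≤ ‖s • x + z‖ + ‖s • x - z‖ := by
  rcases (hr.trans hrs).eq_or_lt with hs | hs
  · have : r = s := by linarith
    rw [this]
  have h1 : 2 * s * ‖r • x + z‖ ≤ (s + r) * ‖s • x + z‖ + (s - r) * ‖s • x - z‖ := by
    have e : (2 * s) • (r • x + z) = (s + r) • (s • x + z) - (s - r) • (s • x - z) := by module
    have := norm_sub_le ((s + r) • (s • x + z)) ((s - r) • (s • x - z))
    rwa [← e, norm_smul, norm_smul, norm_smul, Real.norm_of_nonneg (by positivity),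
      Real.norm_of_nonneg (by positivity), Real.norm_of_nonneg (by linarith)] at this
  have h2 : 2 * s * ‖r • x - z‖ ≤ (s + r) * ‖s • x - z‖ + (s - r) * ‖s • x + z‖ := by
    have e : (2 * s) • (r • x - z) = (s + r) • (s • x - z) - (s - r) • (s • x + z) := by module
    have := norm_sub_le ((s + r) • (s • x - z)) ((s - r) • (s • x + z))
    rwa [← e, norm_smul, norm_smul, norm_smul, Real.norm_of_nonneg (by positivity),
      Real.norm_of_nonneg (by positivity), Real.norm_of_nonneg (by linarith)] at this
  refine le_of_mul_le_mul_left ?_ (by positivity : 0 < 2 * s)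
  linarith

/-- The seminorm `y ↦ ‖‖y‖ x + y‖ + ‖‖y‖ x - y‖`. -/
noncomputable def symmetrizedSeminorm (x : X) : Seminorm ℝ X :=
  Seminorm.of (fun y => ‖‖y‖ • x + y‖ + ‖‖y‖ • x - y‖)
    (fun y z => by
      refine (norm_smul_add_add_norm_smul_sub_mono x (y + z) (norm_nonneg _)
        (norm_add_le y z)).trans ?_
      have h1 := norm_add_le (‖y‖ • x + y) (‖z‖ • x + z)
      have h2 := norm_add_le (‖y‖ • x - y) (‖z‖ • x - z)
      rw [show ‖y‖ • x + y + (‖z‖ • x + z) = (‖y‖ + ‖z‖) • x + (y + z) by module] at h1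
      rw [show ‖y‖ • x - y + (‖z‖ • x - z) = (‖y‖ + ‖z‖) • x - (y + z) by module] at h2
      linarith)
    (fun c y => by
      rw [norm_smul, Real.norm_eq_abs]
      rcases abs_choice c with h | h
      · have e1 : (|c| * ‖y‖) • x + c • y = |c| • (‖y‖ • x + y) := by rw [h]; module
        have e2 : (|c| * ‖y‖) • x - c • y = |c| • (‖y‖ • x - y) := by rw [h]; module
        rw [e1, e2, norm_smul, norm_smul, Real.norm_eq_abs, abs_abs, mul_add]
      · have e1 : (|c| * ‖y‖) • x + c • y = |c| • (‖y‖ • x - y) := by rw [h]; module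
        have e2 : (|c| * ‖y‖) • x - c • y = |c| • (‖y‖ • x + y) := by rw [h]; module
        rw [e1, e2, norm_smul, norm_smul, Real.norm_eq_abs, abs_abs, mul_add, add_comm])

theorem symmetrizedSeminorm_apply (x y : X) :
    symmetrizedSeminorm x y = ‖‖y‖ • x + y‖ + ‖‖y‖ • x - y‖ := rfl

theorem symmetrizedSeminorm_le (x y : X) :
    symmetrizedSeminorm x y ≤ 2 * (1 + ‖x‖) * ‖y‖ := by
  have h1 := norm_add_le (‖y‖ • x) y
  have h2 := norm_sub_le (‖y‖ • x) y
  rw [norm_smul, norm_norm] at h1 h2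
  rw [symmetrizedSeminorm_apply]
  linarith

/-- The excess in the triangle inequality for the vectors `y` and `z`. -/
def Seminorm.defect (N : Seminorm ℝ X) (y z : X) : ℝ := N y + N z - N (y + z)

theorem Seminorm.defect_nonneg (N : Seminorm ℝ X) (y z : X) : 0 ≤ N.defect y z :=
  sub_nonneg.mpr (map_add_le_add N y z)

/-- There is an equivalent norm whose defects control those of the given norm and of countably
many given continuous seminorms. -/
theorem exists_equivalentNorm_defect_le (p : ℕ → Seminorm ℝ X) (C : ℕ → ℝ) (hC0 : ∀ k, 0 < C k)
    (hC : ∀ k y, p k y ≤ C k * ‖y‖) :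
    ∃ N : Seminorm ℝ X, IsEquivalentNorm N ∧
      (∀ y z, (normSeminorm ℝ X).defect y z ≤ N.defect y z) ∧
      ∀ k, ∃ c > 0, ∀ y z, c * (p k).defect y z ≤ N.defect y z := by
  -- The weights bound the series by `∑ (1 / 2) ^ k * ‖y‖ = 2 * ‖y‖`, whence the equivalence
  -- constants `1` and `3`.
  let c : ℕ → ℝ := fun k => (1 / 2) ^ k / C k
  have hc : ∀ k, 0 < c k := fun k => div_pos (by positivity) (hC0 k)
  have hle : ∀ y k, c k * p k y ≤ (1 / 2) ^ k * ‖y‖ := fun y k => by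
    calc c k * p k y ≤ c k * (C k * ‖y‖) := mul_le_mul_of_nonneg_left (hC k y) (hc k).le
      _ = (1 / 2) ^ k * ‖y‖ := by
        have := (hC0 k).ne'
        simp only [c]; field_simp
  have hnn : ∀ y k, 0 ≤ c k * p k y := fun y k => mul_nonneg (hc k).le (apply_nonneg _ _)
  have hsg : ∀ y : X, Summable fun k : ℕ => ((1 : ℝ) / 2) ^ k * ‖y‖ := fun y =>
    summable_geometric_two.mul_right _
  have hs : ∀ y, Summable fun k => c k * p k y := fun y =>
    Summable.of_nonneg_of_le (hnn y) (hle y) (hsg y)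
  let N : Seminorm ℝ X := Seminorm.of (fun y => ‖y‖ + ∑' k, c k * p k y)
    (fun y z => by
      have h1 : ∑' k, c k * p k (y + z) ≤ ∑' k, c k * p k y + ∑' k, c k * p k z := by
        rw [← (hs y).tsum_add (hs z)]
        refine (hs _).tsum_le_tsum (fun k => ?_) ((hs y).add (hs z))
        rw [← mul_add]
        exact mul_le_mul_of_nonneg_left (map_add_le_add _ _ _) (hc k).le
      linarith [norm_add_le y z])
    (fun r y => by
      rw [norm_smul, mul_add, ← tsum_mul_left]
      congr 1
      refine tsum_congr fun k => ?_
      rw [map_smul_eq_mul]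
      ring)
  have hN : ∀ y, N y = ‖y‖ + ∑' k, c k * p k y := fun y => rfl
  -- The defect is linear in the seminorm and each term is nonnegative, so the total dominates every
  -- single one.
  have hd : ∀ y z, N.defect y z =
      (normSeminorm ℝ X).defect y z + ∑' k, c k * (p k).defect y z := fun y z => by
    have e : ∑' k, c k * (p k).defect y z =
        ∑' k, c k * p k y + ∑' k, c k * p k z - ∑' k, c k * p k (y + z) := by
      rw [← (hs y).tsum_add (hs z), ← ((hs y).add (hs z)).tsum_sub (hs _)]
      exact tsum_congr fun k => by rw [Seminorm.defect]; ring
    rw [e, Seminorm.defect, Seminorm.defect, hN, hN, hN]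
    simp only [coe_normSeminorm]
    ring
  have hdn : ∀ y z k, 0 ≤ c k * (p k).defect y z := fun y z k =>
    mul_nonneg (hc k).le ((p k).defect_nonneg y z)
  have hds : ∀ y z, Summable fun k => c k * (p k).defect y z := fun y z =>
    (((hs y).add (hs z)).sub (hs (y + z))).congr fun k => by rw [Seminorm.defect]; ring
  refine ⟨N, ⟨1, 3, one_pos, by norm_num, fun y => ⟨?_, ?_⟩⟩, fun y z => ?_, fun k =>
    ⟨c k, hc k, fun y z => ?_⟩⟩
  · rw [hN, one_mul]
    have : 0 ≤ ∑' k, c k * p k y := tsum_nonneg (hnn y)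
    linarith
  · have := (hs y).tsum_le_tsum (hle y) (hsg y)
    rw [tsum_mul_right, tsum_geometric_two] at this
    rw [hN]
    linarith
  · rw [hd]
    have : 0 ≤ ∑' k, c k * (p k).defect y z := tsum_nonneg (hdn y z)
    linarith
  · rw [hd]
    linarith [(hds y z).le_tsum k fun j _ => hdn y z j, (normSeminorm ℝ X).defect_nonneg y z]

variable {κ : Type*} {F : Filter κ} {ξ η : κ → X} {α β : ℝ}

/-- After the varying norms are replaced by their limits, the symmetrized defect is the sum of a
defect for `d` with plus signs and one with minus signs. Both are nonnegative, so the first tends to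
`0` with the sum. The vanishing norm defect identifies the limit of `‖ξ i + η i‖` as `α + β`. -/
theorem tendsto_norm_defect_of_symmetrizedSeminorm {d : X}
    (hξ : Tendsto (fun i => ‖ξ i‖) F (𝓝 α)) (hη : Tendsto (fun i => ‖η i‖) F (𝓝 β))
    (hn : Tendsto (fun i => (normSeminorm ℝ X).defect (ξ i) (η i)) F (𝓝 0))
    (hd : Tendsto (fun i => (symmetrizedSeminorm d).defect (ξ i) (η i)) F (𝓝 0)) :
    Tendsto (fun i => ‖α • d + ξ i‖ + ‖β • d + η i‖ - ‖(α + β) • d + (ξ i + η i)‖) F (𝓝 0) := by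
  have hsum : Tendsto (fun i => ‖ξ i + η i‖) F (𝓝 (α + β)) := by
    have := (hξ.add hη).sub hn
    rw [sub_zero] at this
    refine this.congr fun i => ?_
    simp [Seminorm.defect]
  -- The factor `2` arises because each of the three norms is a coefficient of `d` in two terms.
  have hup : Tendsto (fun i => (symmetrizedSeminorm d).defect (ξ i) (η i) +
      2 * (|‖ξ i‖ - α| + |‖η i‖ - β| + |‖ξ i + η i‖ - (α + β)|) * ‖d‖) F (𝓝 0) := by
    have h1 := (hξ.sub_const α).abs
    have h2 := (hη.sub_const β).abs
    have h3 := (hsum.sub_const (α + β)).abs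
    have := hd.add ((((h1.add h2).add h3).const_mul 2).mul_const ‖d‖)
    simpa using this
  refine tendsto_of_tendsto_of_tendsto_of_le_of_le tendsto_const_nhds hup (fun i => ?_)
    fun i => ?_
  · have := norm_add_le (α • d + ξ i) (β • d + η i)
    rw [show α • d + ξ i + (β • d + η i) = (α + β) • d + (ξ i + η i) by module] at this
    linarith
  · have pert : ∀ (r s : ℝ) (z : X), |‖r • d + z‖ - ‖s • d + z‖| ≤ |r - s| * ‖d‖ := by
      intro r s z
      refine (abs_norm_sub_norm_le _ _).trans ?_
      rw [show r • d + z - (s • d + z) = (r - s) • d by module, norm_smul, Real.norm_eq_abs]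
    have h := norm_add_le (α • d - ξ i) (β • d - η i)
    rw [show α • d - ξ i + (β • d - η i) = (α + β) • d - (ξ i + η i) by module] at h
    have a1 := abs_le.mp (pert ‖ξ i‖ α (ξ i))
    have a2 := abs_le.mp (pert ‖ξ i‖ α (-ξ i))
    have a3 := abs_le.mp (pert ‖η i‖ β (η i))
    have a4 := abs_le.mp (pert ‖η i‖ β (-η i))
    have a5 := abs_le.mp (pert ‖ξ i + η i‖ (α + β) (ξ i + η i))
    have a6 := abs_le.mp (pert ‖ξ i + η i‖ (α + β) (-(ξ i + η i)))
    simp only [← sub_eq_add_neg] at a2 a4 a6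
    simp only [Seminorm.defect, symmetrizedSeminorm_apply]
    linarith [a1.1, a2.1, a3.1, a4.1, a5.2, a6.2]

/-- The expression is Lipschitz in `x` with constant `|α| + |β| + |α + β|`, uniformly in `i`, so
convergence on a dense set suffices. -/
theorem tendsto_norm_defect_of_denseRange {d : ℕ → X} (hdense : DenseRange d)
    (hξ : Tendsto (fun i => ‖ξ i‖) F (𝓝 α)) (hη : Tendsto (fun i => ‖η i‖) F (𝓝 β))
    (hn : Tendsto (fun i => (normSeminorm ℝ X).defect (ξ i) (η i)) F (𝓝 0))
    (hd : ∀ k, Tendsto (fun i => (symmetrizedSeminorm (d k)).defect (ξ i) (η i)) F (𝓝 0))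
    (x : X) :
    Tendsto (fun i => ‖α • x + ξ i‖ + ‖β • x + η i‖ - ‖(α + β) • x + (ξ i + η i)‖) F (𝓝 0) := by
  set M := |α| + |β| + |α + β| with hM
  rw [Metric.tendsto_nhds]
  intro ε hε
  obtain ⟨k, hk⟩ := hdense.exists_dist_lt x (ε := ε / 2 / (M + 1)) (by positivity)
  rw [dist_eq_norm, lt_div_iff₀ (by positivity)] at hk
  filter_upwards [Metric.tendsto_nhds.mp
    (tendsto_norm_defect_of_symmetrizedSeminorm hξ hη hn (hd k)) (ε / 2) (half_pos hε)] with i hi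
  have pert : ∀ (r : ℝ) (z : X), |‖r • x + z‖ - ‖r • d k + z‖| ≤ |r| * ‖x - d k‖ := by
    intro r z
    refine (abs_norm_sub_norm_le _ _).trans ?_
    rw [show r • x + z - (r • d k + z) = r • (x - d k) by module, norm_smul, Real.norm_eq_abs]
  have a1 := abs_le.mp (pert α (ξ i))
  have a2 := abs_le.mp (pert β (η i))
  have a3 := abs_le.mp (pert (α + β) (ξ i + η i))
  have hM' : |α| * ‖x - d k‖ + |β| * ‖x - d k‖ + |α + β| * ‖x - d k‖ < ε / 2 := by
    have : M * ‖x - d k‖ ≤ ‖x - d k‖ * (M + 1) := by nlinarith [norm_nonneg (x - d k)]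
    rw [hM] at this
    linarith
  rw [Real.dist_eq, sub_zero, abs_lt] at hi ⊢
  constructor <;> linarith [hi.1, hi.2, a1.1, a1.2, a2.1, a2.2, a3.1, a3.2]

end Renorming

/-! ### Assembly of the proof -/

section Main

variable {X : Type*} [NormedAddCommGroup X] [NormedSpace ℝ X]

theorem SchauderBasis.separableSpace (b : SchauderBasis ℝ X) :
    TopologicalSpace.SeparableSpace X := by
  have hcl : closure (Submodule.span ℝ (Set.range b.basis) : Set X) = Set.univ := by
    refine Set.eq_univ_of_forall fun x => ?_
    refine mem_closure_of_tendsto (b.expansion x) (Eventually.of_forall fun s => ?_)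
    exact Submodule.sum_mem _ fun i _ =>
      Submodule.smul_mem _ _ (Submodule.subset_span (Set.mem_range_self i))
  have hsep := (Set.countable_range b.basis).isSeparable.span (R := ℝ) |>.closure
  rw [hcl] at hsep
  exact TopologicalSpace.isSeparable_univ_iff.mp hsep

theorem containsEllOne_of_additive_types [CompleteSpace X] (U : Ultrafilter ℕ) {x y : ℕ → X}
    {α β C : ℝ} (hα : 0 < α) (hβ : 0 < β) (hxC : ∀ m, ‖x m‖ ≤ C) (hyC : ∀ m, ‖y m‖ ≤ C)
    (hx : Tendsto (fun m => ‖x m‖) U (𝓝 α)) (hy : Tendsto (fun n => ‖y n‖) U (𝓝 β))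
    (H : ∀ σ : ℝ, |σ| = 1 → ∀ z, Tendsto (fun i : ℕ × ℕ => ‖α • z + x i.1‖ +
      ‖β • z + σ • y i.2‖ - ‖(α + β) • z + (x i.1 + σ • y i.2)‖)
      ((U : Filter ℕ).curry U) (𝓝 0)) : ContainsEllOne X := by
  set u : ℕ → X := fun m => α⁻¹ • x m with hu
  set w : ℕ → X := fun m => β⁻¹ • y m with hw
  have hxu : ∀ m, x m = α • u m := fun m => by simp [hu, smul_smul, hα.ne']
  have hyw : ∀ m, y m = β • w m := fun m => by simp [hw, smul_smul, hβ.ne']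
  have huC : ∀ m, ‖u m‖ ≤ α⁻¹ * C := fun m => by
    rw [hu, norm_smul, norm_inv, Real.norm_of_nonneg hα.le]
    gcongr
    exact hxC m
  have hwC : ∀ m, ‖w m‖ ≤ β⁻¹ * C := fun m => by
    rw [hw, norm_smul, norm_inv, Real.norm_of_nonneg hβ.le]
    gcongr
    exact hyC m
  have hu1 : Tendsto (fun m => ‖u m‖) U (𝓝 1) := by
    have := hx.const_mul α⁻¹
    rw [inv_mul_cancel₀ hα.ne'] at this
    refine this.congr fun m => ?_
    rw [hu, norm_smul, norm_inv, Real.norm_of_nonneg hα.le]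
  have hw1 : Tendsto (fun m => ‖w m‖) U (𝓝 1) := by
    have := hy.const_mul β⁻¹
    rw [inv_mul_cancel₀ hβ.ne'] at this
    refine this.congr fun m => ?_
    rw [hw, norm_smul, norm_inv, Real.norm_of_nonneg hβ.le]
  clear_value u w
  have hbound : ∀ (v : ℕ → X) (D : ℝ), (∀ m, ‖v m‖ ≤ D) → ∀ z : X × ℝ, ∃ C', ∀ i,
      ((normSeminorm ℝ X).comp (addSmul (v i))) z ≤ C' := fun v D hv z => by
    refine ⟨‖z.1‖ + |z.2| * D, fun i => ?_⟩
    have : ((normSeminorm ℝ X).comp (addSmul (v i))) z = ‖z.1 + z.2 • v i‖ := by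
      rw [Seminorm.comp_apply, ← addSmul_apply]; rfl
    rw [this]
    refine (norm_add_le _ _).trans ?_
    rw [norm_smul, Real.norm_eq_abs]
    gcongr
    exact hv i
  obtain ⟨T, hT'⟩ := exists_seminorm_tendsto U _ (hbound u _ huC)
  obtain ⟨S, hS'⟩ := exists_seminorm_tendsto U _ (hbound w _ hwC)
  have hT : ∀ z t, Tendsto (fun m => ‖z + t • u m‖) U (𝓝 (T (z, t))) := fun z t => by
    simpa using hT' (z, t)
  have hS : ∀ z t, Tendsto (fun m => ‖z + t • w m‖) U (𝓝 (S (z, t))) := fun z t => by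
    simpa using hS' (z, t)
  have hT0 : ∀ z, T (z, 0) = ‖z‖ := fun z =>
    tendsto_nhds_unique (hT z 0) (by simp)
  have hS0 : ∀ z, S (z, 0) = ‖z‖ := fun z =>
    tendsto_nhds_unique (hS z 0) (by simp)
  have hT1 : T (0, 1) = 1 := tendsto_nhds_unique (hT 0 1) (by simpa using hu1)
  have hS1 : S (0, 1) = 1 := tendsto_nhds_unique (hS 0 1) (by simpa using hw1)
  obtain ⟨W, hW'⟩ := exists_seminorm_tendsto U (fun m => S.comp (addSmulPair (u m)))
    fun z => by
      refine ⟨‖z.1‖ + |z.2.1| * (α⁻¹ * C) + |z.2.2|, fun m => ?_⟩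
      have e : (S.comp (addSmulPair (u m))) z = S (z.1 + z.2.1 • u m, z.2.2) := by
        rw [Seminorm.comp_apply, ← addSmulPair_apply]
      rw [e]
      refine (Seminorm.le_norm_add_abs hS0 hS1 _ _).trans ?_
      gcongr
      refine (norm_add_le _ _).trans ?_
      rw [norm_smul, Real.norm_eq_abs]
      gcongr
      exact huC m
  have hW : ∀ z s t, Tendsto (fun m => S (z + s • u m, t)) U (𝓝 (W (z, s, t))) :=
    fun z s t => by simpa using hW' (z, s, t)
  have hWF : ∀ z s t, Tendsto (fun i : ℕ × ℕ => ‖z + s • u i.1 + t • w i.2‖)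
      ((U : Filter ℕ).curry U) (𝓝 (W (z, s, t))) := fun z s t =>
    tendsto_curry_of_tendsto (f := fun m n => ‖z + s • u m + t • w n‖)
      (fun m => hS (z + s • u m) t) (hW z s t)
  have : ((U : Filter ℕ).curry (U : Filter ℕ)).NeBot := by
    rw [neBot_iff]
    intro hbot
    have : ∀ᶠ _ in (U : Filter ℕ).curry (U : Filter ℕ), False := by rw [hbot]; exact eventually_bot
    rw [eventually_curry_iff] at this
    simp only [eventually_false_iff_eq_bot, U.neBot.ne] at this
  -- This is `H` divided by `α + β`, after `x` and `y` are rescaled to `u` and `w`.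
  have hadd : ∀ σ : ℝ, |σ| = 1 → ∀ z,
      α / (α + β) * T (z, 1) + β / (α + β) * S (z, σ) = W (z, α / (α + β), σ * (β / (α + β))) := by
    intro σ hσ z
    have hfst : Tendsto (fun i : ℕ × ℕ => ‖z + (1 : ℝ) • u i.1‖) ((U : Filter ℕ).curry U)
        (𝓝 (T (z, 1))) :=
      tendsto_curry_of_tendsto (f := fun m _ => ‖z + (1 : ℝ) • u m‖)
        (fun m => tendsto_const_nhds) (hT z 1)
    have hsnd : Tendsto (fun i : ℕ × ℕ => ‖z + σ • w i.2‖) ((U : Filter ℕ).curry U)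
        (𝓝 (S (z, σ))) :=
      tendsto_curry_of_tendsto (f := fun _ n => ‖z + σ • w n‖) (fun m => hS z σ)
        tendsto_const_nhds
    have h1 := ((hfst.const_mul (α / (α + β))).add (hsnd.const_mul (β / (α + β)))).sub
      (hWF z (α / (α + β)) (σ * (β / (α + β))))
    have h2 := (H σ hσ z).const_mul (α + β)⁻¹
    rw [mul_zero] at h2
    refine sub_eq_zero.mp (tendsto_nhds_unique h1 (h2.congr fun i => ?_))
    have hpos : 0 < α + β := by positivity
    have e1 : ‖α • z + x i.1‖ = α * ‖z + (1 : ℝ) • u i.1‖ := by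
      rw [one_smul, hxu, ← smul_add, norm_smul, Real.norm_of_nonneg hα.le]
    have e2 : ‖β • z + σ • y i.2‖ = β * ‖z + σ • w i.2‖ := by
      rw [hyw, smul_comm σ β, ← smul_add, norm_smul, Real.norm_of_nonneg hβ.le]
    have e3 : ‖(α + β) • z + (x i.1 + σ • y i.2)‖ =
        (α + β) * ‖z + (α / (α + β)) • u i.1 + (σ * (β / (α + β))) • w i.2‖ := by
      rw [← Real.norm_of_nonneg hpos.le, ← norm_smul, Real.norm_of_nonneg hpos.le]
      congr 1
      rw [smul_add, smul_add, smul_smul (α + β) (α / _), smul_smul (α + β) (σ * _), hxu, hyw,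
        smul_smul σ β, add_assoc, mul_div_cancel₀ _ hpos.ne',
        show (α + β) * (σ * (β / (α + β))) = σ * β by field_simp]
    rw [e1, e2, e3]
    field_simp
  have hpos : 0 < α + β := by positivity
  have A : IsAdditiveAmalgam T S W (α / (α + β)) (β / (α + β)) :=
    { left_zero := hT0
      right_zero := hS0
      left_one := hT1
      right_one := hS1
      amalgam_left := fun z s =>
        tendsto_nhds_unique (hW z s 0) (by simpa only [hS0] using hT z s)
      amalgam_right := fun z t =>
        tendsto_nhds_unique (hW z 0 t) (by simp)
      pos_left := by positivity
      pos_right := by positivity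
      sum_eq := by field_simp
      additive := fun z => by simpa using (hadd 1 (by simp) z).le }
  have A' : IsAdditiveAmalgam T (S.comp (flipSnd X)) (W.comp (flipLast X))
      (α / (α + β)) (β / (α + β)) :=
    { A with
      right_zero := fun z => by simp [hS0]
      right_one := by
        have := map_neg_eq_map S ((0 : X), (1 : ℝ))
        simpa [hS1] using this
      amalgam_left := fun z s => by simp [A.amalgam_left]
      amalgam_right := fun z t => by simp [A.amalgam_right]
      additive := fun z => by simpa using (hadd (-1) (by simp) z).le }
  -- Once `S = T`, the seminorm `W` is also the limit of `T (z + s • u m, t)`, so the selection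
  -- involves `u` alone.
  obtain ⟨hST, hTW⟩ := A.symmetric A'
  obtain ⟨φ, hφ⟩ := exists_ellOne_subfamily huC hT0 hT1 (W := W) (fun z => by
      have := hW' z
      refine this.congr fun m => ?_
      exact hST _ _) hTW fun t => by
    have := map_smul_eq_mul T t ((0 : X), (1 : ℝ))
    simpa [hT1] using this
  exact containsEllOne_of_lower_bound (w := fun i => u (φ i)) (by norm_num : (0 : ℝ) < 1 / 2)
    (fun i => huC (φ i)) hφ

/-- A separable Banach space has an equivalent norm for which two normalized sequences with
`N (x m ± y n) → 2` exist only if the space contains `ℓ₁`. -/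
theorem exists_equivalentNorm_containsEllOne [CompleteSpace X]
    [TopologicalSpace.SeparableSpace X] :
    ∃ N : Seminorm ℝ X, IsEquivalentNorm N ∧ ∀ x y : ℕ → X,
      (∀ m, N (x m) = 1) → (∀ n, N (y n) = 1) →
      Tendsto (fun i : ℕ × ℕ => N (x i.1 + y i.2)) (atTop.curry atTop) (𝓝 2) →
      Tendsto (fun i : ℕ × ℕ => N (x i.1 - y i.2)) (atTop.curry atTop) (𝓝 2) →
      ContainsEllOne X := by
  obtain ⟨N, hN, hnd, hpd⟩ := exists_equivalentNorm_defect_le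
    (fun k => symmetrizedSeminorm (TopologicalSpace.denseSeq X k))
    (fun k => 2 * (1 + ‖TopologicalSpace.denseSeq X k‖)) (fun k => by positivity)
    fun k y => symmetrizedSeminorm_le _ y
  refine ⟨N, hN, fun x y hx hy hplus hminus => ?_⟩
  obtain ⟨c, C, hc, hC, hcC⟩ := hN
  have hbd : ∀ z, N z = 1 → ‖z‖ ≤ c⁻¹ ∧ C⁻¹ ≤ ‖z‖ := fun z hz => by
    obtain ⟨h1, h2⟩ := hcC z
    rw [hz] at h1 h2
    constructor
    · rw [← one_div, le_div_iff₀ hc]; linarith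
    · rw [← one_div, div_le_iff₀ hC]; linarith
  -- An ultrafilter finer than `atTop` makes the bounded norms converge and keeps the given iterated
  -- limits.
  let U := hyperfilter ℕ
  have hU : (U : Filter ℕ) ≤ atTop := Nat.hyperfilter_le_atTop
  have hcurry : (U : Filter ℕ).curry U ≤ (atTop : Filter ℕ).curry (atTop : Filter ℕ) :=
    fun s hs => by
      rw [mem_curry_iff] at hs ⊢
      exact (hs.filter_mono hU).mono fun m hm => hm.filter_mono hU
  have hlim : ∀ z : ℕ → X, (∀ m, N (z m) = 1) →
      ∃ a, 0 < a ∧ Tendsto (fun m => ‖z m‖) U (𝓝 a) := fun z hz => by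
    obtain ⟨a, ha⟩ := U.exists_tendsto_of_abs_le (f := fun m => ‖z m‖) (C := c⁻¹) fun m => by
      rw [abs_norm]; exact (hbd _ (hz m)).1
    exact ⟨a, (inv_pos.mpr hC).trans_le (ge_of_tendsto' ha fun m => (hbd _ (hz m)).2), ha⟩
  obtain ⟨α, hα, hxα⟩ := hlim x hx
  obtain ⟨β, hβ, hyβ⟩ := hlim y hy
  refine containsEllOne_of_additive_types U hα hβ (fun m => (hbd _ (hx m)).1)
    (fun m => (hbd _ (hy m)).1) hxα hyβ fun σ hσ => ?_
  have hNσ : ∀ n, N (σ • y n) = 1 := fun n => by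
    rw [map_smul_eq_mul, Real.norm_eq_abs, hσ, hy, one_mul]
  have hdef : Tendsto (fun i : ℕ × ℕ => N.defect (x i.1) (σ • y i.2))
      ((U : Filter ℕ).curry U) (𝓝 0) := by
    have h2 : Tendsto (fun i : ℕ × ℕ => N (x i.1 + σ • y i.2)) (atTop.curry atTop) (𝓝 2) := by
      rcases eq_or_eq_neg_of_abs_eq hσ with rfl | rfl
      · simpa using hplus
      · simpa [← sub_eq_add_neg] using hminus
    have h3 := (tendsto_const_nhds (x := (2 : ℝ))).sub (h2.mono_left hcurry)
    rw [sub_self] at h3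
    refine h3.congr fun i => ?_
    rw [Seminorm.defect, hx, hNσ]
    norm_num
  refine fun z => tendsto_norm_defect_of_denseRange (TopologicalSpace.denseRange_denseSeq X)
    (tendsto_curry_of_tendsto (f := fun m _ => ‖x m‖) (fun m => tendsto_const_nhds) hxα)
    (tendsto_curry_of_tendsto (f := fun _ n => ‖σ • y n‖) (fun m => ?_) tendsto_const_nhds)
    (squeeze_zero (fun i => Seminorm.defect_nonneg _ _ _) (fun i => hnd _ _) hdef)
    (fun k => ?_) z
  · refine hyβ.congr fun n => ?_
    rw [norm_smul, Real.norm_eq_abs, hσ, one_mul]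
  · obtain ⟨a, ha, hle⟩ := hpd k
    have h4 := hdef.const_mul a⁻¹
    rw [mul_zero] at h4
    refine squeeze_zero (fun i => Seminorm.defect_nonneg _ _ _) (fun i => ?_) h4
    rw [inv_mul_eq_div, le_div_iff₀ ha, mul_comm]
    exact hle _ _

theorem HasIteratedLimit.tendsto_curry {f : ℕ → ℕ → ℝ} {L : ℝ} (h : HasIteratedLimit f L) :
    Tendsto (fun i : ℕ × ℕ => f i.1 i.2) (atTop.curry atTop) (𝓝 L) := by
  obtain ⟨g, hf, hg⟩ := h
  exact tendsto_curry_of_tendsto hf hg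

theorem norm_sum_ellOneBasis (n : ℕ) (a : ℕ → ℝ) :
    ‖∑ i ∈ Finset.range n, a i • ellOneBasis i‖ = ∑ i ∈ Finset.range n, |a i| := by
  have h := lp.norm_sum_single (E := fun _ : ℕ => ℝ) (p := 1) (by simp) a (Finset.range n)
  simp only [ENNReal.toReal_one, Real.rpow_one, Real.norm_eq_abs] at h
  rw [← h]
  congr 1
  refine Finset.sum_congr rfl fun i _ => ?_
  rw [ellOneBasis, ← lp.single_smul, smul_eq_mul, mul_one]

theorem GeneratesAsymptoticModel.norm_eq_one {N : Seminorm ℝ X} {z : ℕ → ℕ → X} {E : Type*}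
    [NormedAddCommGroup E] [NormedSpace ℝ E] [CompleteSpace E] {e : ℕ → E}
    (h : GeneratesAsymptoticModel N z e) (k : ℕ) : ‖e k‖ = 1 := by
  obtain ⟨K, hK⟩ := h.basic
  refine (eq_of_abs_sub_le_all fun δ hδ => ?_).symm
  obtain ⟨M, hM⟩ := h.norm_eq (k + 1) (Pi.single (Fin.last k) 1) δ hδ
  have := hM (fun j => M + j) (fun i j hij => by simpa using hij) fun j => Nat.le_add_right _ _
  simp only [Pi.single_apply, ite_smul, one_smul, zero_smul, Finset.sum_ite_eq',
    Finset.mem_univ, if_true, Fin.val_last, hK.normalized] at this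
  exact this.le

/-- In the iterated order the second index is taken after the first, so the pairs are eventually
increasing, as `norm_eq` requires. -/
theorem GeneratesAsymptoticModel.tendsto_pair {N : Seminorm ℝ X} {z : ℕ → ℕ → X} {E : Type*}
    [NormedAddCommGroup E] [NormedSpace ℝ E] [CompleteSpace E] {e : ℕ → E}
    (h : GeneratesAsymptoticModel N z e) (r s : ℝ) :
    Tendsto (fun i : ℕ × ℕ => N (r • z 0 i.1 + s • z 1 i.2)) (atTop.curry atTop)
      (𝓝 ‖r • e 0 + s • e 1‖) := by
  rw [Metric.tendsto_nhds]
  intro δ hδ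
  obtain ⟨M, hM⟩ := h.norm_eq 2 ![r, s] δ hδ
  rw [eventually_curry_iff]
  filter_upwards [eventually_ge_atTop M] with m hm
  filter_upwards [eventually_gt_atTop m] with n hn
  have := hM ![m, n] (by
    intro i j hij
    fin_cases i <;> fin_cases j <;> simp_all) (by
    intro j
    fin_cases j
    · simpa using hm
    · simpa using hm.trans hn.le)
  simpa [Fin.sum_univ_two, Real.dist_eq] using this

/-- Testing on one normalized vector gives `A ≥ 1`, so `A * B ≤ 1` forces `B ≤ 1`; the upper
estimate on two vectors then reads `2 ≤ B * ‖e 0 + σ • e 1‖`. -/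
theorem norm_add_smul_eq_two_of_equivalent {E : Type*} [NormedAddCommGroup E] [NormedSpace ℝ E]
    {e : ℕ → E} (h0 : ‖e 0‖ = 1) (h1 : ‖e 1‖ = 1) (h : AreEquivalentSeqs 1 e ellOneBasis)
    {σ : ℝ} (hσ : |σ| = 1) : ‖e 0 + σ • e 1‖ = 2 := by
  obtain ⟨A, B, hA, hB, hAB, h⟩ := h
  have hA1 : 1 ≤ A := by
    have := (h 1 fun _ => 1).1
    rw [norm_sum_ellOneBasis] at this
    simp only [Finset.sum_range_one, one_smul, h0, mul_one, abs_one] at this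
    exact (inv_le_one₀ hA).mp this
  have hB1 : B ≤ 1 := by nlinarith
  have h2 := (h 2 fun i => if i = 0 then 1 else σ).2
  rw [norm_sum_ellOneBasis] at h2
  simp only [Finset.sum_range_succ, Finset.sum_range_zero, zero_add, if_true, one_smul,
    one_ne_zero, if_false, abs_one, hσ] at h2
  have h3 := norm_add_le (e 0) (σ • e 1)
  rw [norm_smul, Real.norm_eq_abs, hσ, h0, h1] at h3
  nlinarith [norm_nonneg (e 0 + σ • e 1)]

end Main

theorem theorem4p8 {X : Type u} [NormedAddCommGroup X] [NormedSpace ℝ X]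
    [CompleteSpace X] (b : SchauderBasis ℝ X) :
    (∃ N : Seminorm ℝ X, IsEquivalentNorm N ∧
      ∀ x y : ℕ → X, IsBlockBasis b x → IsBlockBasis b y →
        (∀ m, N (x m) = 1) → (∀ n, N (y n) = 1) →
        HasIteratedLimit (fun m n => N (x m + y n)) 2 →
        HasIteratedLimit (fun m n => N (x m - y n)) 2 →
        ContainsEllOne X) ∧
    (¬ ContainsEllOne X →
      ∃ N : Seminorm ℝ X, IsEquivalentNorm N ∧
        ∀ (z : ℕ → ℕ → X) (E : Type v) [NormedAddCommGroup E] [NormedSpace ℝ E]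
          [CompleteSpace E] (e : ℕ → E),
          IsBlockBasicArray N b z → GeneratesAsymptoticModel N z e →
          ¬ AreEquivalentSeqs 1 e ellOneBasis) := by
  have := SchauderBasis.separableSpace b
  obtain ⟨N, hN, h⟩ := exists_equivalentNorm_containsEllOne (X := X)
  refine ⟨⟨N, hN, fun x y _ _ hx hy hplus hminus =>
    h x y hx hy hplus.tendsto_curry hminus.tendsto_curry⟩, fun hX => ⟨N, hN, ?_⟩⟩
  intro z E _ _ _ e _ hz he
  obtain ⟨K, hK⟩ := hz.basic
  have hplus := hz.tendsto_pair 1 1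
  have hminus := hz.tendsto_pair 1 (-1)
  rw [one_smul, norm_add_smul_eq_two_of_equivalent (hz.norm_eq_one 0) (hz.norm_eq_one 1) he
    (by simp)] at hplus hminus
  refine hX (h (z 0) (z 1) (hK.normalized 0) (hK.normalized 1) ?_ ?_)
  · simpa using hplus
  · simpa [← sub_eq_add_neg] using hminus
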